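/- Let $H$ be a real separable Hilbert space, let $(Z,Y)$ be a random pair with joint distribution $\mu$ on a product of measurable spaces $\mathcal Z\times\mathcal Y$, let $\phi\colon\mathcal Z\to H$ be measurable with $\mathbb E\|\phi(Z)\|^p\le\nu^p$ for some $p\in(1,2]$ and $\nu>0$, and let $\ell\colon\mathbb R\times\mathcal Y\to[0,\infty)$ be measurable in the second argument, convex and Lipschitz with constant $\mathcal L>0$ in the first argument, with $\mathbb E[\ell(0,Y)]<\infty$. Let $\ell'\colon\mathbb R\times\mathcal Y\to\mathbb R$ be measurable with $\ell'(t,y)$ a subgradient of $\ell(\cdot,y)$ at $t$ for all $(t,y)$. Put $R(x)=\mathbb E[\ell(\langle x,\phi(Z)\rangle,Y)]$ for $x\in H$, assume that $R$ attains its minimum $R^*$ on $H$, and put $L=\mathcal L\,\mathbb E\|\phi(Z)\|$ and $L_\varepsilon=(1+\varepsilon)L$ with $\varepsilon>0$. Given a batch size $m\ge1$, a point $x_1\in H$, and i.i.d. copies $(Z^i_j,Y^i_j)_{i\ge1,\,1\le j\le m}$ of $(Z,Y)$, the clipped stochastic subgradient method (C-SsGM) with stepsizes $\gamma_i$ and clipping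 levels $\lambda_i$ is $$\bar u_i=\frac1m\sum_{j=1}^m \ell'(\langle x_i,\phi(Z^i_j)\rangle,Y^i_j)\,\phi(Z^i_j),\qquad x_{i+1}=x_i-\gamma_i\,\max\{\|\bar u_i\|/\lambda_i,1\}^{-1}\,\bar u_i .$$ For a horizon $k\ge1$ take $\gamma_i=\gamma/k^{1/p}$ and $\lambda_i=\max\{L_\varepsilon,k^{1/p}\}$ for all $1\le i\le k$, and let $\bar x_k=\frac1k\sum_{i=1}^k x_i$. Then there is a constant $c\ge0$, independent of $k$ and $\delta$, such that the following hold for every $\delta\in(0,2/e]$ and every $k\ge1$. (i) If $\gamma=(\log(2/\delta))^{-1}$, then with probability at least $1-\delta$, $$R(\bar x_k)-R^*\le c\,\frac{1+\log(1/\delta)}{k^{(p-1)/p}} .$$ (ii) If $\gamma=(\log(2/\delta))^{-1/2}$, then with probability at least $1-\delta$, $$R(\bar x_k)-R^*\le c\,\sqrt{\log(2/\delta)}\;\frac{1+\log(1/\delta)}{k^{(p-1)/p}} ;$$ thus, for each fixed $\delta$, $R(\bar x_k)-R^*\lesssim (1+\log(1/\delta))/k^{(p-1)/p}$ with a constant that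 does not depend on $k$. -/

import Mathlib

open MeasureTheory ProbabilityTheory

noncomputable section

namespace ClippedSsGM

/-- The clipping operator `CLIP(u, lam) = max {‖u‖ / lam, 1}⁻¹ • u`. -/
def clip {H : Type*} [NormedAddCommGroup H] [InnerProductSpace ℝ H] (u : H) (lam : ℝ) : H :=
  (max (‖u‖ / lam) 1)⁻¹ • u

/-- The average `ū` of the stochastic oracle `g` at `x` over a batch of `m` samples. -/
def batchOracle {H Ξ : Type*} [NormedAddCommGroup H] [InnerProductSpace ℝ H] {m : ℕ}
    (g : H → Ξ → H) (x : H) (b : Fin m → Ξ) : H :=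
  (m : ℝ)⁻¹ • ∑ j, g x (b j)

/-- The iterates of the clipped stochastic subgradient method on the whole space (the projection
onto the constraint set is the identity), as a function of the sample batches.
Indices are shifted by one: `iterate … s n` is the iterate `x_{n+1}`, and `step n`, `level n`,
`s n` are the stepsize, the clipping level and the batch used in iteration `n + 1`. -/
def iterate {H Ξ : Type*} [NormedAddCommGroup H] [InnerProductSpace ℝ H] {m : ℕ}
    (g : H → Ξ → H) (step level : ℕ → ℝ) (x₁ : H) (s : ℕ → Fin m → Ξ) : ℕ → H
  | 0 => x₁
  | n + 1 =>
      iterate g step level x₁ s n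
        - step n • clip (batchOracle g (iterate g step level x₁ s n) (s n)) (level n)

/-- The averaged iterate `x̄_k = (1 / k) ∑_{i = 1}^k x_i`. -/
def average {H Ξ : Type*} [NormedAddCommGroup H] [InnerProductSpace ℝ H] {m : ℕ}
    (g : H → Ξ → H) (step level : ℕ → ℝ) (x₁ : H) (s : ℕ → Fin m → Ξ) (k : ℕ) : H :=
  (k : ℝ)⁻¹ • ∑ n ∈ Finset.range k, iterate g step level x₁ s n

/-- Finite-horizon stepsize `γ_i ≡ γ / k^(1/p)`. -/
def fhStep (p γ : ℝ) (k : ℕ) : ℕ → ℝ :=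
  fun _ => γ / (k : ℝ) ^ (1 / p)

/-- Finite-horizon clipping level `λ_i ≡ max {Lε, lam * k^(1/p)}`. -/
def fhLevel (p Lε lam : ℝ) (k : ℕ) : ℕ → ℝ :=
  fun _ => max Lε (lam * (k : ℝ) ^ (1 / p))

/-- The risk `R(x) = E[ℓ(⟨x, φ(Z)⟩, Y)]`, where `μ` is the joint distribution of `(Z, Y)`. -/
def risk {H 𝒵 𝒴 : Type*} [NormedAddCommGroup H] [InnerProductSpace ℝ H]
    [MeasurableSpace 𝒵] [MeasurableSpace 𝒴]
    (μ : Measure (𝒵 × 𝒴)) (φ : 𝒵 → H) (ℓ : ℝ → 𝒴 → ℝ) (x : H) : ℝ :=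
  ∫ w, ℓ (inner ℝ x (φ w.1)) w.2 ∂μ

/-- `ℓ'` selects subgradients of `ℓ(·, y)`: `ℓ'(t, y) ∈ ∂ℓ(·, y)(t)` for all `t` and `y`. -/
def IsSubgradientSelection {𝒴 : Type*} (ℓ ℓ' : ℝ → 𝒴 → ℝ) : Prop :=
  ∀ t y s, ℓ t y + ℓ' t y * (s - t) ≤ ℓ s y

/-- The supervised learning oracle `û(x, (z, y)) = ℓ'(⟨x, φ(z)⟩, y) φ(z)`. -/
def slOracle {H 𝒵 𝒴 : Type*} [NormedAddCommGroup H] [InnerProductSpace ℝ H]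
    (φ : 𝒵 → H) (ℓ' : ℝ → 𝒴 → ℝ) (x : H) (w : 𝒵 × 𝒴) : H :=
  ℓ' (inner ℝ x (φ w.1)) w.2 • φ w.1

end ClippedSsGM

end

/-! The domain is unbounded, so the squared distance to a minimizer `xs` is a poor potential: its
noise term grows with that distance. The argument uses ψ(x) = √(1 + ‖x - xs‖²) instead. Along one
step, `potential_step_le` bounds the growth of ψ plus the weighted excess η (f x - f xs)/ψ by a
noise term ⟨e - c, x - xs⟩/ψ and a quadratic term; since ‖x - xs‖ ≤ ψ, both are controlled by the
clipped oracle c and its unclipped mean e, however far x lies.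

With q = k^(-1/p), clipping keeps the scaled step q‖c‖ bounded, and the p-th moment of q‖u‖ is of
order 1/k. The clipping bias and the second moment of qc are paid for by that p-th moment, so the
exponential moment of one step, scaled by 1/γ, is at most exp(C/k) (`lintegral_exp_clip_step_le`,
`lintegral_exp_potential_step_le`). Over k steps this costs only a constant C, and Ville's
inequality (`measure_exists_le_prod_le`) gives, with probability at least 1 - δ, that ψ plus the
accumulated weighted excess stays below K = ψ(x₁) + γ (log(1/δ) + C) at all times n ≤ k.

On that event the bound serves twice: it confines every iterate to ψ ≤ K, and then the excesses sum
to at most K²/η. Convexity turns this into K²/(kη) for the average, with kη = γ k^((p-1)/p). -/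

noncomputable section

namespace ClippedSsGM

open scoped ENNReal

/-! ### Ville's inequality for systems driven by independent noise -/

/-- The states of a random dynamical system are measurable with respect to the past noise. -/
lemma measurable_state_past {E B Ω : Type*} [MeasurableSpace E] [MeasurableSpace B]
    {Y : ℕ → Ω → E} {b : ℕ → Ω → B} {F : E × B → E} (hF : Measurable F) {y₀ : E}
    (hY0 : ∀ ω, Y 0 ω = y₀) (hY : ∀ n ω, Y (n + 1) ω = F (Y n ω, b n ω)) (n : ℕ) :
    Measurable[⨆ i ∈ Set.Iio n, MeasurableSpace.comap (b i) inferInstance] (Y n) := by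
  induction n with
  | zero =>
    have : Y 0 = fun _ => y₀ := funext hY0
    rw [this]
    exact measurable_const
  | succ n ih =>
    have : Y (n + 1) = fun ω => F (Y n ω, b n ω) := funext (hY n)
    rw [this]
    refine hF.comp (Measurable.prodMk ?_ ?_)
    · exact ih.mono (biSup_mono fun i hi => lt_trans hi (Nat.lt_succ_self n)) le_rfl
    · exact (comap_measurable (b n)).mono
        (le_biSup (fun i => MeasurableSpace.comap (b i) inferInstance)
          (show n ∈ Set.Iio (n + 1) from Nat.lt_succ_self n)) le_rfl

/-- Fresh noise can be integrated out first. -/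
lemma lintegral_state_noise {E B Ω : Type*} [MeasurableSpace E] [MeasurableSpace B]
    [MeasurableSpace Ω] {P : Measure Ω} [IsProbabilityMeasure P]
    {Y : ℕ → Ω → E} {b : ℕ → Ω → B} {F : E × B → E} (hF : Measurable F) {y₀ : E}
    (hY0 : ∀ ω, Y 0 ω = y₀) (hY : ∀ n ω, Y (n + 1) ω = F (Y n ω, b n ω))
    (hb : ∀ n, Measurable (b n))
    (hindep : ∀ n, Indep (⨆ i ∈ Set.Iio n, MeasurableSpace.comap (b i) inferInstance)
      (MeasurableSpace.comap (b n) inferInstance) P)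
    (n : ℕ) {f : E × B → ℝ≥0∞} (hf : Measurable f) :
    ∫⁻ ω, f (Y n ω, b n ω) ∂P = ∫⁻ ω, ∫⁻ β, f (Y n ω, β) ∂(P.map (b n)) ∂P := by
  have hpast := measurable_state_past hF hY0 hY n
  have hYm : Measurable (Y n) :=
    hpast.mono (iSup₂_le fun i _ => (hb i).comap_le) le_rfl
  have hI : IndepFun (Y n) (b n) P :=
    indep_of_indep_of_le_left (hindep n) hpast.comap_le
  have := Measure.isProbabilityMeasure_map (μ := P) (hb n).aemeasurable
  have := Measure.isProbabilityMeasure_map (μ := P) hYm.aemeasurable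
  rw [← lintegral_map hf (hYm.prodMk (hb n)),
    hI.map_prod_eq_prod_map_map hYm.aemeasurable (hb n).aemeasurable,
    lintegral_prod _ hf.aemeasurable, lintegral_map hf.lintegral_prod_right' hYm]

/-- **Ville's inequality** for products of conditionally normalized factors. -/
lemma measure_exists_le_prod_le {E B Ω : Type*} [MeasurableSpace E] [MeasurableSpace B]
    [MeasurableSpace Ω] {P : Measure Ω} [IsProbabilityMeasure P]
    {X : ℕ → Ω → E} {b : ℕ → Ω → B} {F : E × B → E} (hF : Measurable F) {x₀ : E}
    (hX0 : ∀ ω, X 0 ω = x₀) (hX : ∀ n ω, X (n + 1) ω = F (X n ω, b n ω))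
    (hb : ∀ n, Measurable (b n))
    (hindep : ∀ n, Indep (⨆ i ∈ Set.Iio n, MeasurableSpace.comap (b i) inferInstance)
      (MeasurableSpace.comap (b n) inferInstance) P)
    {g : E × B → ℝ≥0∞} (hg : Measurable g)
    (hg1 : ∀ n x, ∫⁻ β, g (x, β) ∂(P.map (b n)) ≤ 1)
    {a : ℝ≥0∞} (ha : a ≠ 0) (ha' : a ≠ ∞) (k : ℕ) :
    P {ω | ∃ n ≤ k, a ≤ ∏ i ∈ Finset.range n, g (X i ω, b i ω)} ≤ a⁻¹ := by
  classical
  -- The running product is frozen once it reaches `a`. A crossing at any n ≤ k is then still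
  -- visible at time k, where Markov's inequality applies. Carrying the state along with the product
  -- keeps the pair a dynamical system driven by the same noise.
  set G : (ℝ≥0∞ × E) × B → ℝ≥0∞ := fun q =>
    if a ≤ q.1.1 then q.1.1 else q.1.1 * g (q.1.2, q.2) with hG
  have hGm : Measurable G := by
    refine Measurable.ite (measurableSet_le measurable_const (by fun_prop)) (by fun_prop) ?_
    exact Measurable.mul (by fun_prop) (hg.comp (by fun_prop))
  let Y : Ω → ℕ → ℝ≥0∞ × E := fun ω n =>
    Nat.rec (1, x₀) (fun n y => (G (y, b n ω), F (y.2, b n ω))) n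
  have hY2 : ∀ n ω, (Y ω n).2 = X n ω := by
    intro n ω
    induction n with
    | zero => exact (hX0 ω).symm
    | succ n ih => rw [hX, ← ih]
  have hYs : ∀ n ω, (Y ω (n + 1)).1 = G (Y ω n, b n ω) := fun n ω => rfl
  have hFm : Measurable (fun q : (ℝ≥0∞ × E) × B => (G q, F (q.1.2, q.2))) :=
    hGm.prodMk (hF.comp (by fun_prop))
  have hmean : ∀ n, ∫⁻ ω, (Y ω n).1 ∂P ≤ 1 := by
    intro n
    induction n with
    | zero => simp [Y]
    | succ n ih =>
      simp only [hYs]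
      rw [lintegral_state_noise (Y := fun n ω => Y ω n) hFm (y₀ := (1, x₀)) (fun _ => rfl)
        (fun _ _ => rfl) hb hindep n hGm]
      refine le_trans (lintegral_mono fun ω => ?_) ih
      have := Measure.isProbabilityMeasure_map (μ := P) (hb n).aemeasurable
      simp only [hG]
      split_ifs with h
      · simp
      · rw [lintegral_const_mul _ (show Measurable fun β => g ((Y ω n).2, β) from
          hg.comp measurable_prodMk_left)]
        exact mul_le_of_le_one_right' (hg1 n _)
  -- A frozen value never drops back below `a`; hence a small final value means that freezing never
  -- occurred and the stopped product is the true one.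
  have hfrozen : ∀ ω, (Y ω k).1 < a → ∀ n ≤ k,
      (∏ i ∈ Finset.range n, g (X i ω, b i ω)) = (Y ω n).1 ∧ (Y ω n).1 < a := by
    intro ω hk
    have hlt : ∀ n ≤ k, (Y ω n).1 < a := by
      intro n hn
      by_contra! hcon
      have : ∀ j, (Y ω (n + j)).1 = (Y ω n).1 := by
        intro j
        induction j with
        | zero => rfl
        | succ j ih =>
          rw [← add_assoc, hYs, hG]
          simp only
          rw [if_pos (by rw [ih]; exact hcon), ih]
      obtain ⟨j, rfl⟩ := Nat.exists_eq_add_of_le hn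
      rw [this j] at hk
      exact absurd hk (not_lt.mpr hcon)
    intro n hn
    refine ⟨?_, hlt n hn⟩
    induction n with
    | zero => simp [Y]
    | succ n ih =>
      rw [Finset.prod_range_succ, ih (by omega), hYs, hG]
      simp only
      rw [if_neg (not_le.mpr (hlt n (by omega))), hY2]
  have hYm : Measurable (fun ω => Y ω k) :=
    (measurable_state_past (Y := fun n ω => Y ω n) hFm (y₀ := (1, x₀)) (fun _ => rfl)
      (fun _ _ => rfl) k).mono (iSup₂_le fun i _ => (hb i).comap_le) le_rfl
  have hsub : {ω | ∃ n ≤ k, a ≤ ∏ i ∈ Finset.range n, g (X i ω, b i ω)} ⊆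
      {ω | a ≤ (Y ω k).1} := by
    rintro ω ⟨n, hn, h⟩
    by_contra hcon
    obtain ⟨h1, h2⟩ := hfrozen ω (not_le.mp hcon) n hn
    exact absurd (h1 ▸ h) (not_le.mpr h2)
  calc P _ ≤ P {ω | a ≤ (Y ω k).1} := measure_mono hsub
    _ ≤ (∫⁻ ω, (Y ω k).1 ∂P) / a :=
        meas_ge_le_lintegral_div (measurable_fst.comp hYm).aemeasurable ha ha'
    _ ≤ 1 / a := ENNReal.div_le_div_right (hmean k) a
    _ = a⁻¹ := one_div a

/-! ### Independence and law of the batches -/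

/-- Consecutive batches of an independent array: past batches are independent of the next one. -/
lemma indep_past_batch {Ξ Ω : Type*} [MeasurableSpace Ξ] [MeasurableSpace Ω] {P : Measure Ω}
    {m : ℕ} {ξ : ℕ → Fin m → Ω → Ξ} (hξ : ∀ i j, Measurable (ξ i j))
    (hindep : iIndepFun (fun ij : ℕ × Fin m => ξ ij.1 ij.2) P) (n : ℕ) :
    Indep (⨆ i ∈ Set.Iio n, MeasurableSpace.comap (fun ω j => ξ i j ω) inferInstance)
      (MeasurableSpace.comap (fun ω j => ξ n j ω) inferInstance) P := by
  have hle : ∀ i (S : Set (ℕ × Fin m)), (∀ j, (i, j) ∈ S) →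
      MeasurableSpace.comap (fun ω j => ξ i j ω) inferInstance ≤
        ⨆ ij ∈ S, MeasurableSpace.comap (ξ ij.1 ij.2) inferInstance := by
    intro i S hS
    refine Measurable.comap_le ?_
    refine @measurable_pi_lambda _ _ _ (_) _ _ fun j => ?_
    exact (comap_measurable (ξ i j)).mono
      (le_biSup (fun ij : ℕ × Fin m => MeasurableSpace.comap (ξ ij.1 ij.2) inferInstance)
        (hS j)) le_rfl
  have hdisj : Disjoint {ij : ℕ × Fin m | ij.1 < n} {ij : ℕ × Fin m | ij.1 = n} := by
    rw [Set.disjoint_left]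
    rintro ⟨i, j⟩ h1 h2
    simp only [Set.mem_ofPred_eq] at h1 h2
    omega
  have hI := indep_iSup_of_disjoint (fun ij : ℕ × Fin m => (hξ ij.1 ij.2).comap_le)
    hindep hdisj
  refine indep_of_indep_of_le_left (indep_of_indep_of_le_right hI ?_) ?_
  · exact hle n _ fun j => rfl
  · exact iSup₂_le fun i hi => hle i _ fun j => hi

/-- The law of a batch of an independent array. -/
lemma map_batch_eq_pi {Ξ Ω : Type*} [MeasurableSpace Ξ] [MeasurableSpace Ω] {P : Measure Ω}
    [IsProbabilityMeasure P] {μ : Measure Ξ}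
    {m : ℕ} {ξ : ℕ → Fin m → Ω → Ξ} (hξ : ∀ i j, Measurable (ξ i j))
    (hlaw : ∀ i j, P.map (ξ i j) = μ)
    (hindep : iIndepFun (fun ij : ℕ × Fin m => ξ ij.1 ij.2) P) (n : ℕ) :
    P.map (fun ω j => ξ n j ω) = Measure.pi (fun _ => μ) := by
  have h : iIndepFun (fun j => ξ n j) P :=
    hindep.precomp (g := fun j : Fin m => (n, j)) fun a b h => (Prod.mk.inj h).2
  rw [(iIndepFun_iff_map_fun_eq_pi_map fun j => (hξ n j).aemeasurable).1 h]
  simp [hlaw]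

/-! ### Norm estimates for the clipping operator -/

section Clip

variable {H : Type*} [NormedAddCommGroup H] [InnerProductSpace ℝ H]

lemma norm_clip (u : H) (lam : ℝ) : ‖clip u lam‖ = (max (‖u‖ / lam) 1)⁻¹ * ‖u‖ := by
  have : 0 ≤ max (‖u‖ / lam) 1 := le_max_of_le_right zero_le_one
  rw [clip, norm_smul, Real.norm_of_nonneg (inv_nonneg.2 this)]

lemma norm_clip_le_norm (u : H) (lam : ℝ) : ‖clip u lam‖ ≤ ‖u‖ := by
  rw [norm_clip]
  exact mul_le_of_le_one_left (norm_nonneg _) (inv_le_one_of_one_le₀ (le_max_right _ _))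

lemma norm_clip_le (u : H) {lam : ℝ} (hlam : 0 < lam) : ‖clip u lam‖ ≤ lam := by
  have h1 : (0 : ℝ) < max (‖u‖ / lam) 1 := lt_max_of_lt_right zero_lt_one
  rw [norm_clip, inv_mul_le_iff₀ h1, ← div_le_iff₀ hlam]
  exact le_max_left _ _

lemma clip_eq_self {u : H} {lam : ℝ} (hlam : 0 < lam) (hu : ‖u‖ ≤ lam) : clip u lam = u := by
  rw [clip, max_eq_right ((div_le_one hlam).2 hu), inv_one, one_smul]

lemma norm_sub_clip_le_norm (u : H) (lam : ℝ) : ‖u - clip u lam‖ ≤ ‖u‖ := by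
  have h1 : (1 : ℝ) ≤ max (‖u‖ / lam) 1 := le_max_right _ _
  have h2 : (max (‖u‖ / lam) 1)⁻¹ ≤ 1 := inv_le_one_of_one_le₀ h1
  have h3 : 0 ≤ (max (‖u‖ / lam) 1)⁻¹ := inv_nonneg.2 (zero_le_one.trans h1)
  have : u - clip u lam = (1 - (max (‖u‖ / lam) 1)⁻¹) • u := by rw [clip, sub_smul, one_smul]
  rw [this, norm_smul, Real.norm_of_nonneg (by linarith)]
  exact mul_le_of_le_one_left (norm_nonneg _) (by linarith)

/-- The clipping error is controlled by a power of the norm. -/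
lemma mul_norm_sub_clip_le (u : H) {lam q p : ℝ} (hlam : 0 < lam) (hq : 0 < q) (hp : 1 ≤ p)
    (hqlam : 1 ≤ q * lam) : q * ‖u - clip u lam‖ ≤ (q * ‖u‖) ^ p := by
  rcases le_or_gt ‖u‖ lam with h | h
  · rw [clip_eq_self hlam h, sub_self, norm_zero, mul_zero]
    positivity
  · have h1 : 1 ≤ q * ‖u‖ := hqlam.trans (mul_le_mul_of_nonneg_left h.le hq.le)
    calc q * ‖u - clip u lam‖ ≤ q * ‖u‖ := by gcongr; exact norm_sub_clip_le_norm u lam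
      _ = (q * ‖u‖) ^ (1 : ℝ) := (Real.rpow_one _).symm
      _ ≤ (q * ‖u‖) ^ p := Real.rpow_le_rpow_of_exponent_le h1 hp

/-- The second moment of a clipped vector is controlled by a lower moment. -/
lemma sq_mul_norm_clip_le (u : H) {lam q p Λ : ℝ} (hlam : 0 < lam) (hq : 0 < q) (hp : 1 ≤ p)
    (hp2 : p ≤ 2) (hΛ : 1 ≤ Λ) (hqlam : q * lam ≤ Λ) :
    (q * ‖clip u lam‖) ^ 2 ≤ Λ * (q * ‖u‖) ^ p := by
  have h0 : 0 ≤ q * ‖clip u lam‖ := by positivity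
  have h1 : q * ‖clip u lam‖ ≤ Λ :=
    (mul_le_mul_of_nonneg_left (norm_clip_le u hlam) hq.le).trans hqlam
  -- Interpolation: the ceiling Λ absorbs the power 2 - p, and in the remaining power p clipping
  -- only shrinks the norm.
  calc (q * ‖clip u lam‖) ^ 2 = (q * ‖clip u lam‖) ^ (2 - p) * (q * ‖clip u lam‖) ^ p := by
        rw [← Real.rpow_add' h0 (by norm_num), sub_add_cancel, Real.rpow_two]
    _ ≤ Λ ^ (2 - p) * (q * ‖u‖) ^ p := by
        have := norm_clip_le_norm u lam
        gcongr
    _ ≤ Λ ^ (1 : ℝ) * (q * ‖u‖) ^ p := by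
        gcongr
        linarith
    _ = Λ * (q * ‖u‖) ^ p := by rw [Real.rpow_one]

end Clip

/-! ### Exponential moment and potential drift of one step -/

/-- Second-order Taylor remainder. Keeping the linear term exact lets its centred part vanish on
integration. -/
lemma exp_le_one_add_add_sq_mul_exp {t a : ℝ} (h : |t| ≤ a) :
    Real.exp t ≤ 1 + t + t ^ 2 * Real.exp a := by
  have h1 := Complex.norm_exp_sub_sum_le_norm_mul_exp (t : ℂ) 2
  have h2 : Complex.exp t - ∑ m ∈ Finset.range 2, (t : ℂ) ^ m / (m.factorial : ℂ)
      = ((Real.exp t - (1 + t) : ℝ) : ℂ) := by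
    simp [Finset.sum_range_succ]
  rw [h2, Complex.norm_real, Complex.norm_real, Real.norm_eq_abs, Real.norm_eq_abs, sq_abs] at h1
  have h3 : t ^ 2 * Real.exp |t| ≤ t ^ 2 * Real.exp a := by gcongr
  linarith [le_abs_self (Real.exp t - (1 + t))]

/-- Concavity: the square root lies below its tangent at `b`. -/
lemma sqrt_sub_sqrt_le {a b : ℝ} (ha : 0 ≤ a) (hb : 0 < b) :
    √a - √b ≤ (a - b) / (2 * √b) := by
  have hb' := Real.sqrt_pos.2 hb
  rw [le_div_iff₀ (by positivity)]
  nlinarith [sq_nonneg (√a - √b), Real.sq_sqrt ha, Real.sq_sqrt hb.le]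

/-- The factor in front of the scaled `p`-th moment in the one-step bound. -/
def momentFactor (L Λ : ℝ) : ℝ :=
  1 + Λ / 2 + 2 * (1 + Λ / 2) ^ 2 * Λ * Real.exp (L + Λ + Λ ^ 2 / 2)

lemma momentFactor_nonneg (L : ℝ) {Λ : ℝ} (hΛ : 0 ≤ Λ) : 0 ≤ momentFactor L Λ := by
  unfold momentFactor
  positivity

/-- Exponential moment of one clipped step, measured against a unit-speed potential. -/
lemma lintegral_exp_clip_step_le {H B : Type*} [NormedAddCommGroup H] [InnerProductSpace ℝ H]
    [CompleteSpace H] [MeasurableSpace B] (π : Measure B) [IsProbabilityMeasure π] {u : B → H}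
    (hu : Integrable u π) {p q lam Λ L W : ℝ} (hp : 1 ≤ p) (hp2 : p ≤ 2) (hq : 0 < q)
    (hq1 : q ≤ 1) (hlam : 0 < lam) (hqlam : 1 ≤ q * lam) (hqlam' : q * lam ≤ Λ)
    (hup : Integrable (fun b => (q * ‖u b‖) ^ p) π) (hW : ∫ b, (q * ‖u b‖) ^ p ∂π ≤ W)
    (hL : ‖∫ b, u b ∂π‖ ≤ L) (d : H) {ψ : ℝ} (hψ : 0 < ψ) (hd : ‖d‖ ≤ ψ) :
    ∫⁻ b, ENNReal.ofReal (Real.exp (q * inner ℝ (∫ b, u b ∂π - clip (u b) lam) d / ψ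
        + (q * ‖clip (u b) lam‖) ^ 2 / 2)) ∂π
      ≤ ENNReal.ofReal (1 + momentFactor L Λ * W
          + 2 * (q * L) ^ 2 * Real.exp (L + Λ + Λ ^ 2 / 2)) := by
  set e : H := ∫ b, u b ∂π with he
  set a : ℝ := L + Λ + Λ ^ 2 / 2 with ha
  have hL0 : 0 ≤ L := (norm_nonneg _).trans hL
  have hΛ : 1 ≤ Λ := hqlam.trans hqlam'
  have hcs : ∀ v : H, |inner ℝ v d / ψ| ≤ ‖v‖ := by
    intro v
    rw [abs_div, abs_of_pos hψ, div_le_iff₀ hψ]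
    exact (abs_real_inner_le_norm v d).trans (by gcongr)
  -- Pointwise majorant of the exponential. Its last summand has mean zero, so only the q² term and
  -- the p-th moment survive beyond the 1.
  set U : B → ℝ := fun b => (1 + 2 * (q * L) ^ 2 * Real.exp a)
    + momentFactor L Λ * (q * ‖u b‖) ^ p + q / ψ * inner ℝ d (e - u b) with hU
  have hpt : ∀ b, Real.exp (q * inner ℝ (e - clip (u b) lam) d / ψ
      + (q * ‖clip (u b) lam‖) ^ 2 / 2) ≤ U b := by
    intro b
    set c := clip (u b) lam with hc
    set t := q * inner ℝ (e - c) d / ψ + (q * ‖c‖) ^ 2 / 2 with ht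
    set y := q * ‖c‖ with hy
    have hy0 : 0 ≤ y := by positivity
    have hyΛ : y ≤ Λ :=
      (mul_le_mul_of_nonneg_left (norm_clip_le (u b) hlam) hq.le).trans hqlam'
    have hec : |q * inner ℝ (e - c) d / ψ| ≤ q * L + y := by
      rw [mul_div_assoc, abs_mul, abs_of_pos hq, hy, ← mul_add]
      gcongr
      exact (hcs _).trans ((norm_sub_le _ _).trans (by gcongr))
    have hqL : q * L ≤ L := mul_le_of_le_one_left hL0 hq1
    have habs : |t| ≤ q * L + (1 + Λ / 2) * y := by
      calc |t| ≤ (q * L + y) + y ^ 2 / 2 := by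
            refine (abs_add_le _ _).trans (add_le_add hec ?_)
            rw [abs_of_nonneg (by positivity)]
        _ ≤ q * L + (1 + Λ / 2) * y := by nlinarith
    have hta : |t| ≤ a := by
      rw [ha]
      nlinarith
    have hsq : t ^ 2 ≤ 2 * (q * L) ^ 2 + 2 * (1 + Λ / 2) ^ 2 * (Λ * (q * ‖u b‖) ^ p) := by
      have h1 : y ^ 2 ≤ Λ * (q * ‖u b‖) ^ p :=
        sq_mul_norm_clip_le (u b) hlam hq hp hp2 hΛ hqlam'
      calc t ^ 2 = |t| ^ 2 := (sq_abs t).symm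
        _ ≤ (q * L + (1 + Λ / 2) * y) ^ 2 := by gcongr
        _ ≤ 2 * (q * L) ^ 2 + 2 * (1 + Λ / 2) ^ 2 * y ^ 2 := by
            nlinarith [sq_nonneg (q * L - (1 + Λ / 2) * y)]
        _ ≤ _ := by gcongr
    -- Splitting e - c = (e - u) + (u - c) separates centred noise from clipping bias; the bias is
    -- charged to the p-th power.
    have hlin : t ≤ q / ψ * inner ℝ d (e - u b) + (q * ‖u b‖) ^ p
        + Λ / 2 * (q * ‖u b‖) ^ p := by
      have h1 : y ^ 2 ≤ Λ * (q * ‖u b‖) ^ p :=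
        sq_mul_norm_clip_le (u b) hlam hq hp hp2 hΛ hqlam'
      have h2 : q * (inner ℝ (u b - c) d / ψ) ≤ (q * ‖u b‖) ^ p :=
        (mul_le_mul_of_nonneg_left ((le_abs_self _).trans (hcs _)) hq.le).trans
          (mul_norm_sub_clip_le (u b) hlam hq hp hqlam)
      have h3 : q * inner ℝ (e - c) d / ψ
          = q / ψ * inner ℝ d (e - u b) + q * (inner ℝ (u b - c) d / ψ) := by
        rw [show e - c = (e - u b) + (u b - c) by abel, inner_add_left,
          real_inner_comm d (e - u b)]
        ring
      rw [ht, h3]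
      linarith
    have hexp := exp_le_one_add_add_sq_mul_exp hta
    have hmul := mul_le_mul_of_nonneg_right hsq (Real.exp_nonneg a)
    -- In `momentFactor`, 1 + Λ/2 comes from `hlin` and the exponential part from `hsq`.
    simp only [hU, momentFactor, ← ha]
    nlinarith
  have hi1 : Integrable (fun b => momentFactor L Λ * (q * ‖u b‖) ^ p) π := hup.const_mul _
  have hsubi : Integrable (fun b => e - u b) π := (integrable_const e).sub hu
  have hi2 : Integrable (fun b => q / ψ * inner ℝ d (e - u b)) π :=
    (hsubi.const_inner d).const_mul _
  have hi3 : Integrable (fun b => (1 + 2 * (q * L) ^ 2 * Real.exp a)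
      + momentFactor L Λ * (q * ‖u b‖) ^ p) π := (integrable_const _).add hi1
  have hUi : Integrable U π := hi3.add hi2
  have hzero : ∫ b, q / ψ * inner ℝ d (e - u b) ∂π = 0 := by
    rw [integral_const_mul, integral_inner hsubi,
      integral_sub (integrable_const e) hu, integral_const]
    simp [he]
  have hUint : ∫ b, U b ∂π ≤ 1 + momentFactor L Λ * W + 2 * (q * L) ^ 2 * Real.exp a := by
    have h1 : ∫ b, U b ∂π = (1 + 2 * (q * L) ^ 2 * Real.exp a)
        + momentFactor L Λ * ∫ b, (q * ‖u b‖) ^ p ∂π := by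
      simp only [hU]
      rw [integral_add hi3 hi2, hzero, add_zero,
        integral_add (integrable_const _) hi1, integral_const_mul, integral_const]
      simp
    rw [h1]
    have := mul_le_mul_of_nonneg_left hW (momentFactor_nonneg L (by linarith : 0 ≤ Λ))
    linarith
  calc _ ≤ ∫⁻ b, ENNReal.ofReal (U b) ∂π :=
        lintegral_mono fun b => ENNReal.ofReal_le_ofReal (hpt b)
    _ = ENNReal.ofReal (∫ b, U b ∂π) :=
        (ofReal_integral_eq_lintegral_ofReal hUi
          (ae_of_all _ fun b => (Real.exp_nonneg _).trans (hpt b))).symm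
    _ ≤ _ := ENNReal.ofReal_le_ofReal hUint

/-- Drift of the potential `√(1 + ‖x - xs‖²)` along a subgradient step. -/
lemma potential_step_le {H : Type*} [NormedAddCommGroup H] [InnerProductSpace ℝ H]
    (x xs c e : H) {η r : ℝ} (hη : 0 ≤ η) (hr : r ≤ inner ℝ e (x - xs)) :
    √(1 + ‖x - η • c - xs‖ ^ 2) - √(1 + ‖x - xs‖ ^ 2) + η * r / √(1 + ‖x - xs‖ ^ 2)
      ≤ η * inner ℝ (e - c) (x - xs) / √(1 + ‖x - xs‖ ^ 2) + (η * ‖c‖) ^ 2 / 2 := by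
  set ψ := √(1 + ‖x - xs‖ ^ 2) with hψ
  have hψ1 : 1 ≤ ψ := Real.one_le_sqrt.2 (by nlinarith [sq_nonneg ‖x - xs‖])
  have hψ0 : 0 < ψ := by linarith
  have h1 := sqrt_sub_sqrt_le (a := 1 + ‖x - η • c - xs‖ ^ 2) (b := 1 + ‖x - xs‖ ^ 2)
    (by positivity) (by positivity)
  rw [← hψ] at h1
  have h2 : ‖x - η • c - xs‖ ^ 2
      = ‖x - xs‖ ^ 2 - 2 * (η * inner ℝ c (x - xs)) + (η * ‖c‖) ^ 2 := by
    rw [show x - η • c - xs = (x - xs) - η • c by abel, norm_sub_sq_real, inner_smul_right,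
      norm_smul, Real.norm_of_nonneg hη, real_inner_comm]
  have h3 : η * r ≤ η * inner ℝ e (x - xs) := mul_le_mul_of_nonneg_left hr hη
  -- The 1 under the root ensures ψ ≥ 1, which frees the quadratic term of its denominator.
  have h4 : (η * ‖c‖) ^ 2 / ψ ≤ (η * ‖c‖) ^ 2 := div_le_self (by positivity) hψ1
  have h5 : η * r / ψ ≤ η * inner ℝ e (x - xs) / ψ := by gcongr
  have h6 : (1 + ‖x - η • c - xs‖ ^ 2 - (1 + ‖x - xs‖ ^ 2)) / (2 * ψ)
      = - (η * inner ℝ c (x - xs) / ψ) + (η * ‖c‖) ^ 2 / ψ / 2 := by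
    rw [h2]
    field_simp
    ring
  rw [inner_sub_left, mul_sub, sub_div]
  linarith

/-! ### Subgradient oracle and risk of supervised learning -/

section Oracle

variable {H 𝒵 𝒴 : Type*} [NormedAddCommGroup H] [InnerProductSpace ℝ H] {φ : 𝒵 → H}
  {ℓ ℓ' : ℝ → 𝒴 → ℝ} {Lip : ℝ}

/-- The subgradient inequality is tested at t + 1 and t - 1. -/
lemma abs_subgradient_le (hlip : ∀ y s t, |ℓ s y - ℓ t y| ≤ Lip * |s - t|)
    (hsub : IsSubgradientSelection ℓ ℓ') (t : ℝ) (y : 𝒴) : |ℓ' t y| ≤ Lip := by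
  have h1 := hsub t y (t + 1)
  have h2 := hsub t y (t - 1)
  have h3 := (le_abs_self _).trans (hlip y (t + 1) t)
  have h4 := (le_abs_self _).trans (hlip y (t - 1) t)
  rw [abs_le]
  simp only [add_sub_cancel_left, sub_sub_cancel_left, abs_neg, abs_one, mul_one] at *
  constructor <;> linarith

lemma norm_slOracle_le (hlip : ∀ y s t, |ℓ s y - ℓ t y| ≤ Lip * |s - t|)
    (hsub : IsSubgradientSelection ℓ ℓ') (x : H) (w : 𝒵 × 𝒴) :
    ‖slOracle φ ℓ' x w‖ ≤ Lip * ‖φ w.1‖ := by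
  rw [slOracle, norm_smul, Real.norm_eq_abs]
  gcongr
  exact abs_subgradient_le hlip hsub _ _

end Oracle

section Risk

variable {H 𝒵 𝒴 : Type*} [NormedAddCommGroup H] [InnerProductSpace ℝ H]
    [MeasurableSpace 𝒵] [MeasurableSpace 𝒴] {μ : Measure (𝒵 × 𝒴)} {φ : 𝒵 → H}
    {ℓ ℓ' : ℝ → 𝒴 → ℝ} {Lip : ℝ}

lemma measurable_uncurry_loss (hmeas : ∀ t, Measurable (ℓ t))
    (hlip : ∀ y s t, |ℓ s y - ℓ t y| ≤ Lip * |s - t|) : Measurable (Function.uncurry ℓ) := by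
  refine measurable_uncurry_of_continuous_of_measurable (fun y => ?_) hmeas
  refine (LipschitzWith.of_dist_le_mul (K := Lip.toNNReal) fun s t => ?_).continuous
  rw [Real.dist_eq, Real.dist_eq]
  exact (hlip y s t).trans (by gcongr; exact Real.le_coe_toNNReal Lip)

variable [MeasurableSpace H] [BorelSpace H] [SecondCountableTopology H]

lemma measurable_uncurry_slOracle (hφ : Measurable φ)
    (hmeas : Measurable (fun q : ℝ × 𝒴 => ℓ' q.1 q.2)) :
    Measurable (fun q : H × (𝒵 × 𝒴) => slOracle φ ℓ' q.1 q.2) := by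
  have h1 : Measurable (fun q : H × (𝒵 × 𝒴) => (inner ℝ q.1 (φ q.2.1), q.2.2)) :=
    Measurable.prodMk (measurable_fst.inner (hφ.comp (by fun_prop))) (by fun_prop)
  exact (hmeas.comp h1).smul (hφ.comp (by fun_prop : Measurable fun q : H × (𝒵 × 𝒴) => q.2.1))

lemma measurable_uncurry_inner_loss (hφ : Measurable φ) (hmeas : ∀ t, Measurable (ℓ t))
    (hlip : ∀ y s t, |ℓ s y - ℓ t y| ≤ Lip * |s - t|) :
    Measurable (fun q : H × (𝒵 × 𝒴) => ℓ (inner ℝ q.1 (φ q.2.1)) q.2.2) := by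
  have h1 : Measurable (fun q : H × (𝒵 × 𝒴) => (inner ℝ q.1 (φ q.2.1), q.2.2)) :=
    Measurable.prodMk (measurable_fst.inner (hφ.comp (by fun_prop))) (by fun_prop)
  exact (measurable_uncurry_loss hmeas hlip).comp h1

lemma measurable_risk [SFinite μ] (hφ : Measurable φ) (hmeas : ∀ t, Measurable (ℓ t))
    (hlip : ∀ y s t, |ℓ s y - ℓ t y| ≤ Lip * |s - t|) : Measurable (risk μ φ ℓ) :=
  (StronglyMeasurable.integral_prod_right (ν := μ)
    (f := fun (x : H) (w : 𝒵 × 𝒴) => ℓ (inner ℝ x (φ w.1)) w.2)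
    (measurable_uncurry_inner_loss hφ hmeas hlip).stronglyMeasurable).measurable

lemma integrable_slOracle (hφ : Measurable φ) (hφi : Integrable (fun w => φ w.1) μ)
    (hlip : ∀ y s t, |ℓ s y - ℓ t y| ≤ Lip * |s - t|)
    (hmeas : Measurable (fun q : ℝ × 𝒴 => ℓ' q.1 q.2))
    (hsub : IsSubgradientSelection ℓ ℓ') (x : H) : Integrable (slOracle φ ℓ' x) μ := by
  have hm : Measurable (slOracle φ ℓ' x) :=
    (measurable_uncurry_slOracle hφ hmeas).comp measurable_prodMk_left
  exact (hφi.norm.const_mul Lip).mono' hm.aestronglyMeasurable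
    (ae_of_all _ (norm_slOracle_le hlip hsub x))

lemma integrable_inner_loss (hφ : Measurable φ) (hφi : Integrable (fun w => φ w.1) μ)
    (hLip : 0 ≤ Lip) (hmeas : ∀ t, Measurable (ℓ t))
    (hlip : ∀ y s t, |ℓ s y - ℓ t y| ≤ Lip * |s - t|)
    (hint : Integrable (fun w : 𝒵 × 𝒴 => ℓ 0 w.2) μ) (x : H) :
    Integrable (fun w : 𝒵 × 𝒴 => ℓ (inner ℝ x (φ w.1)) w.2) μ := by
  have hm : Measurable (fun w : 𝒵 × 𝒴 => ℓ (inner ℝ x (φ w.1)) w.2) :=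
    (measurable_uncurry_inner_loss hφ hmeas hlip).comp measurable_prodMk_left
  refine (hint.norm.add (hφi.norm.const_mul (Lip * ‖x‖))).mono' hm.aestronglyMeasurable
    (ae_of_all _ fun w => ?_)
  have h1 := hlip w.2 (inner ℝ x (φ w.1)) 0
  rw [sub_zero] at h1
  have h2 : Lip * |inner ℝ x (φ w.1)| ≤ Lip * ‖x‖ * ‖φ w.1‖ := by
    rw [mul_assoc]
    exact mul_le_mul_of_nonneg_left (abs_real_inner_le_norm _ _) hLip
  simp only [Pi.add_apply, Real.norm_eq_abs]
  have h3 := abs_sub_abs_le_abs_sub (ℓ (inner ℝ x (φ w.1)) w.2) (ℓ 0 w.2)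
  linarith

/-- The mean of the oracle is a subgradient of the risk. -/
lemma risk_sub_risk_le [CompleteSpace H] (hφ : Measurable φ)
    (hφi : Integrable (fun w => φ w.1) μ)
    (hLip : 0 ≤ Lip) (hmeas : ∀ t, Measurable (ℓ t))
    (hlip : ∀ y s t, |ℓ s y - ℓ t y| ≤ Lip * |s - t|)
    (hint : Integrable (fun w : 𝒵 × 𝒴 => ℓ 0 w.2) μ)
    (hmeas' : Measurable (fun q : ℝ × 𝒴 => ℓ' q.1 q.2))
    (hsub : IsSubgradientSelection ℓ ℓ') (x z : H) :
    risk μ φ ℓ x - risk μ φ ℓ z ≤ inner ℝ (∫ w, slOracle φ ℓ' x w ∂μ) (x - z) := by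
  have hi := integrable_inner_loss hφ hφi hLip hmeas hlip hint
  have hg := integrable_slOracle hφ hφi hlip hmeas' hsub x
  rw [risk, risk, ← integral_sub (hi x) (hi z), real_inner_comm, ← integral_inner hg]
  refine integral_mono ((hi x).sub (hi z)) (hg.const_inner _) fun w => ?_
  have h1 := hsub (inner ℝ x (φ w.1)) w.2 (inner ℝ z (φ w.1))
  simp only [slOracle, inner_smul_right, inner_sub_left]
  linarith

lemma convexOn_risk (hφ : Measurable φ) (hφi : Integrable (fun w => φ w.1) μ)
    (hLip : 0 ≤ Lip) (hmeas : ∀ t, Measurable (ℓ t))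
    (hconv : ∀ y, ConvexOn ℝ Set.univ (fun t => ℓ t y))
    (hlip : ∀ y s t, |ℓ s y - ℓ t y| ≤ Lip * |s - t|)
    (hint : Integrable (fun w : 𝒵 × 𝒴 => ℓ 0 w.2) μ) :
    ConvexOn ℝ Set.univ (risk μ φ ℓ) := by
  have hi := integrable_inner_loss hφ hφi hLip hmeas hlip hint
  refine ⟨convex_univ, fun x _ z _ a b ha hb hab => ?_⟩
  simp only [risk, smul_eq_mul]
  rw [← integral_const_mul, ← integral_const_mul,
    ← integral_add ((hi x).const_mul a) ((hi z).const_mul b)]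
  refine integral_mono (hi _) (((hi x).const_mul a).add ((hi z).const_mul b)) fun w => ?_
  have := (hconv w.2).2 (Set.mem_univ (inner ℝ x (φ w.1))) (Set.mem_univ (inner ℝ z (φ w.1)))
    ha hb hab
  simpa only [inner_add_left, real_inner_smul_left, smul_eq_mul] using this

end Risk

/-! ### Mean and moments of batch averages -/

/-- Jensen's inequality for t ↦ t^p. The envelope `h` does not involve `x`, so the resulting moment
bound can be used uniformly along the iterates. -/
lemma norm_batchOracle_rpow_le {H Ξ : Type*} [NormedAddCommGroup H]
    [InnerProductSpace ℝ H] {m : ℕ} (hm : 1 ≤ m) {g : H → Ξ → H} {p : ℝ} (hp : 1 ≤ p) {x : H} {h : Ξ → ℝ}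
    (hgh : ∀ w, ‖g x w‖ ≤ h w) (b : Fin m → Ξ) :
    ‖batchOracle g x b‖ ^ p ≤ (m : ℝ)⁻¹ * ∑ j, h (b j) ^ p := by
  have hm0 : (m : ℝ) ≠ 0 := by positivity
  have hh : ∀ w, 0 ≤ h w := fun w => (norm_nonneg _).trans (hgh w)
  calc ‖batchOracle g x b‖ ^ p ≤ (∑ j : Fin m, (m : ℝ)⁻¹ * h (b j)) ^ p := by
        gcongr
        rw [batchOracle, norm_smul, Real.norm_of_nonneg (by positivity), ← Finset.mul_sum]
        gcongr
        exact (norm_sum_le _ _).trans (Finset.sum_le_sum fun j _ => hgh _)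
    _ ≤ ∑ j : Fin m, (m : ℝ)⁻¹ * h (b j) ^ p :=
        Real.rpow_arith_mean_le_arith_mean_rpow _ _ _ (fun _ _ => by positivity)
          (by simp [hm0]) (fun _ _ => hh _) hp
    _ = _ := by rw [Finset.mul_sum]

section Batch

variable {H Ξ : Type*} [NormedAddCommGroup H] [InnerProductSpace ℝ H] [MeasurableSpace Ξ]
    {μ : Measure Ξ} [IsProbabilityMeasure μ] {m : ℕ} {g : H → Ξ → H}

lemma integrable_batchOracle {x : H} (hg : Integrable (g x) μ) :
    Integrable (fun b : Fin m → Ξ => batchOracle g x b) (Measure.pi fun _ => μ) := by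
  refine (integrable_finsetSum _ fun j _ => ?_).smul (m : ℝ)⁻¹
  exact integrable_comp_eval (μ := fun _ : Fin m => μ) (i := j) hg

lemma integral_batchOracle (hm : 1 ≤ m) {x : H} (hg : Integrable (g x) μ) :
    ∫ b : Fin m → Ξ, batchOracle g x b ∂(Measure.pi fun _ => μ) = ∫ w, g x w ∂μ := by
  have h1 : ∀ j : Fin m, ∫ b : Fin m → Ξ, g x (b j) ∂(Measure.pi fun _ => μ) = ∫ w, g x w ∂μ :=
    fun j => integral_comp_eval (μ := fun _ : Fin m => μ) (i := j) hg.aestronglyMeasurable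
  have hm0 : (m : ℝ) ≠ 0 := by positivity
  simp only [batchOracle]
  rw [integral_smul, integral_finsetSum _ fun j _ =>
    integrable_comp_eval (μ := fun _ : Fin m => μ) (i := j) hg]
  simp only [h1, Finset.sum_const, Finset.card_univ, Fintype.card_fin]
  rw [← Nat.cast_smul_eq_nsmul ℝ, smul_smul, inv_mul_cancel₀ hm0, one_smul]

/-- Moments of a batch average do not exceed those of a bound for a single sample. -/
lemma moment_batchOracle_le (hm : 1 ≤ m) {p : ℝ} (hp : 1 ≤ p) {x : H} (hg : Integrable (g x) μ)
    {h : Ξ → ℝ} (hgh : ∀ w, ‖g x w‖ ≤ h w) (hh : Integrable (fun w => h w ^ p) μ) :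
    Integrable (fun b : Fin m → Ξ => ‖batchOracle g x b‖ ^ p) (Measure.pi fun _ => μ) ∧
      ∫ b : Fin m → Ξ, ‖batchOracle g x b‖ ^ p ∂(Measure.pi fun _ => μ)
        ≤ ∫ w, h w ^ p ∂μ := by
  have hm0 : (m : ℝ) ≠ 0 := by positivity
  have hj : ∀ j : Fin m, Integrable (fun b : Fin m → Ξ => h (b j) ^ p) (Measure.pi fun _ => μ) :=
    fun j => integrable_comp_eval (μ := fun _ : Fin m => μ) (i := j) hh
  have hdom : Integrable (fun b : Fin m → Ξ => (m : ℝ)⁻¹ * ∑ j, h (b j) ^ p)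
      (Measure.pi fun _ => μ) := (integrable_finsetSum _ fun j _ => hj j).const_mul _
  have hi : Integrable (fun b : Fin m → Ξ => ‖batchOracle g x b‖ ^ p) (Measure.pi fun _ => μ) := by
    refine hdom.mono' ?_ (ae_of_all _ fun b => ?_)
    · exact ((integrable_batchOracle hg).aestronglyMeasurable.norm.aemeasurable.pow_const
        p).aestronglyMeasurable
    · rw [Real.norm_of_nonneg (by positivity)]
      exact norm_batchOracle_rpow_le hm hp hgh b
  refine ⟨hi, (integral_mono hi hdom (norm_batchOracle_rpow_le hm hp hgh)).trans_eq ?_⟩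
  have h1 : ∀ j : Fin m, ∫ b : Fin m → Ξ, h (b j) ^ p ∂(Measure.pi fun _ => μ)
      = ∫ w, h w ^ p ∂μ :=
    fun j => integral_comp_eval (μ := fun _ : Fin m => μ) (i := j) (f := fun w => h w ^ p)
      hh.aestronglyMeasurable
  rw [integral_const_mul, integral_finsetSum _ fun j _ => hj j]
  simp only [h1, Finset.sum_const, Finset.card_univ, Fintype.card_fin, nsmul_eq_mul]
  rw [← mul_assoc, inv_mul_cancel₀ hm0, one_mul]

lemma measurable_uncurry_batchOracle [MeasurableSpace H] [BorelSpace H]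
    [SecondCountableTopology H] (hg : Measurable (fun q : H × Ξ => g q.1 q.2)) :
    Measurable (fun q : H × (Fin m → Ξ) => batchOracle g q.1 q.2) := by
  refine Measurable.const_smul (Finset.measurable_fun_sum _ fun j _ => ?_) _
  exact hg.comp (measurable_fst.prodMk ((measurable_pi_apply j).comp measurable_snd))

lemma measurable_clip [MeasurableSpace H] [BorelSpace H] [SecondCountableTopology H] (lam : ℝ) :
    Measurable (fun u : H => clip u lam) := by
  unfold clip
  fun_prop

end Batch

/-! ### High-probability bound for a general convex objective -/

/-- The potential `√(1 + ‖x - xs‖²)`. -/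
def potential {H : Type*} [NormedAddCommGroup H] (xs x : H) : ℝ := √(1 + ‖x - xs‖ ^ 2)

lemma one_le_potential {H : Type*} [NormedAddCommGroup H] (xs x : H) : 1 ≤ potential xs x :=
  Real.one_le_sqrt.2 (by nlinarith [sq_nonneg ‖x - xs‖])

lemma norm_sub_le_potential {H : Type*} [NormedAddCommGroup H] (xs x : H) :
    ‖x - xs‖ ≤ potential xs x :=
  Real.le_sqrt_of_sq_le (by linarith)

/-- Total growth rate over the horizon of the exponential potential. -/
def horizonFactor (L Λ V : ℝ) : ℝ :=
  momentFactor L Λ * V + 2 * L ^ 2 * Real.exp (L + Λ + Λ ^ 2 / 2)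

/-- This scaling makes p-th moments of order 1/k, so that k steps add up to a constant. -/
lemma inv_rpow_one_div_rpow {p : ℝ} (hp : 0 < p) (k : ℕ) :
    (((k : ℝ) ^ (1 / p))⁻¹) ^ p = (k : ℝ)⁻¹ := by
  rw [Real.inv_rpow (by positivity), ← Real.rpow_mul (by positivity), one_div,
    inv_mul_cancel₀ hp.ne', Real.rpow_one]

section Generic

variable {H Ξ Ω : Type*} [NormedAddCommGroup H] [InnerProductSpace ℝ H] [CompleteSpace H]
  [MeasurableSpace Ξ] [MeasurableSpace Ω] {μ : Measure Ξ} [IsProbabilityMeasure μ] {P : Measure Ω}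
  [IsProbabilityMeasure P] {g : H → Ξ → H} {f : H → ℝ} {h : Ξ → ℝ} {m : ℕ}
  {xs : H} {p L Lε V γ : ℝ} {k : ℕ}

/-- Normalized exponential growth of the potential along one clipped step. -/
lemma lintegral_exp_potential_step_le (hm : 1 ≤ m) (hp : 1 ≤ p) (hp2 : p ≤ 2) {x : H}
    (hgi : Integrable (g x) μ) (hgL : ‖∫ w, g x w ∂μ‖ ≤ L)
    (hgh : ∀ w, ‖g x w‖ ≤ h w) (hh : Integrable (fun w => h w ^ p) μ)
    (hV : ∫ w, h w ^ p ∂μ ≤ V)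
    (hsub : f x - f xs ≤ inner ℝ (∫ w, g x w ∂μ) (x - xs))
    (hγ : 0 < γ) (hγ1 : γ ≤ 1) (hk : 1 ≤ k) :
    ∫⁻ b : Fin m → Ξ, ENNReal.ofReal (Real.exp ((potential xs
        (x - fhStep p γ k 0 • clip (batchOracle g x b) (fhLevel p Lε 1 k 0))
        - potential xs x + fhStep p γ k 0 * (f x - f xs) / potential xs x) / γ
        - horizonFactor L (max Lε 1) V / k)) ∂(Measure.pi fun _ => μ) ≤ 1 := by
  have hp0 : 0 < p := by linarith
  have hk1 : (1 : ℝ) ≤ k := by exact_mod_cast hk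
  have hk0 : (0 : ℝ) < k := by linarith
  set s : ℝ := (k : ℝ) ^ (1 / p) with hs
  have hs1 : 1 ≤ s := Real.one_le_rpow hk1 (by positivity)
  have hs0 : 0 < s := by linarith
  set q : ℝ := s⁻¹ with hq
  have hq0 : 0 < q := inv_pos.2 hs0
  have hq1 : q ≤ 1 := inv_le_one_of_one_le₀ hs1
  have hqp : q ^ p = (k : ℝ)⁻¹ := inv_rpow_one_div_rpow hp0 k
  set lam : ℝ := fhLevel p Lε 1 k 0 with hlam
  have hlam' : lam = max Lε s := by rw [hlam, fhLevel, one_mul]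
  have hlams : s ≤ lam := by rw [hlam']; exact le_max_right _ _
  have hqs : q * s = 1 := inv_mul_cancel₀ hs0.ne'
  have hqlam : 1 ≤ q * lam := by
    rw [← hqs]
    exact mul_le_mul_of_nonneg_left hlams hq0.le
  set Λ : ℝ := max Lε 1 with hΛ
  -- In the scale q the clipping level lies between 1 and Λ, uniformly in k.
  have hqlam' : q * lam ≤ Λ := by
    have : lam ≤ Λ * s := by
      rw [hlam']
      have h1 : (1 : ℝ) ≤ Λ := le_max_right _ _
      refine max_le ?_ (le_mul_of_one_le_left hs0.le h1)
      exact (le_max_left Lε 1).trans (le_mul_of_one_le_right (by linarith) hs1)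
    calc q * lam ≤ q * (Λ * s) := by gcongr
      _ = Λ * (q * s) := by ring
      _ = Λ := by rw [hqs, mul_one]
  have hη : fhStep p γ k 0 = γ * q := by rw [fhStep, div_eq_mul_inv]
  set C : ℝ := horizonFactor L Λ V with hC
  set ψ := potential xs x with hψ
  have hψ1 : 1 ≤ ψ := one_le_potential xs x
  obtain ⟨hmi, hmV⟩ := moment_batchOracle_le hm hp hgi hgh hh
  have hscale : ∀ b : Fin m → Ξ, (q * ‖batchOracle g x b‖) ^ p
      = (k : ℝ)⁻¹ * ‖batchOracle g x b‖ ^ p := fun b => by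
    rw [Real.mul_rpow hq0.le (norm_nonneg _), hqp]
  have hstep := lintegral_exp_clip_step_le (Measure.pi fun _ : Fin m => μ)
    (integrable_batchOracle hgi) hp hp2 hq0 hq1 (hs0.trans_le hlams) hqlam hqlam'
    (by simp only [hscale]; exact hmi.const_mul _)
    (W := (k : ℝ)⁻¹ * V) (L := L)
    (by
      simp only [hscale]
      rw [integral_const_mul]
      gcongr
      exact hmV.trans hV)
    (by rw [integral_batchOracle hm hgi]; exact hgL) (x - xs) (ψ := ψ) (by linarith)
    (norm_sub_le_potential xs x)
  rw [integral_batchOracle hm hgi] at hstep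
  set e := ∫ w, g x w ∂μ with he
  have hpt : ∀ b : Fin m → Ξ, (potential xs
        (x - fhStep p γ k 0 • clip (batchOracle g x b) lam)
        - ψ + fhStep p γ k 0 * (f x - f xs) / ψ) / γ
      ≤ q * inner ℝ (e - clip (batchOracle g x b) lam) (x - xs) / ψ
        + (q * ‖clip (batchOracle g x b) lam‖) ^ 2 / 2 := by
    intro b
    have h1 := potential_step_le x xs (clip (batchOracle g x b) lam) e
      (η := fhStep p γ k 0) (by rw [hη]; positivity) hsub
    change potential xs _ - ψ + _ / ψ ≤ _ / ψ + _ at h1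
    rw [div_le_iff₀ hγ]
    refine h1.trans ?_
    rw [hη]
    -- After division by γ the quadratic term keeps one factor γ, which is at most 1.
    have h2 : γ * (γ * (q * ‖clip (batchOracle g x b) lam‖) ^ 2)
        ≤ γ * (1 * (q * ‖clip (batchOracle g x b) lam‖) ^ 2) := by gcongr
    have h3 : γ * q * inner ℝ (e - clip (batchOracle g x b) lam) (x - xs) / ψ
        = q * inner ℝ (e - clip (batchOracle g x b) lam) (x - xs) / ψ * γ := by ring
    rw [h3]
    nlinarith
  have hgrow : 1 + momentFactor L Λ * ((k : ℝ)⁻¹ * V)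
      + 2 * (q * L) ^ 2 * Real.exp (L + Λ + Λ ^ 2 / 2) ≤ Real.exp (C / k) := by
    -- Since q ≤ 1 and p ≤ 2, q² is at most q^p.
    have hq2 : q ^ 2 ≤ (k : ℝ)⁻¹ := by
      rw [← hqp, ← Real.rpow_two]
      exact Real.rpow_le_rpow_of_exponent_ge hq0 hq1 hp2
    have h1 : 2 * (q * L) ^ 2 * Real.exp (L + Λ + Λ ^ 2 / 2)
        ≤ (k : ℝ)⁻¹ * (2 * L ^ 2 * Real.exp (L + Λ + Λ ^ 2 / 2)) := by
      calc _ = q ^ 2 * (2 * L ^ 2 * Real.exp (L + Λ + Λ ^ 2 / 2)) := by ring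
        _ ≤ _ := by gcongr
    have h2 := Real.add_one_le_exp (C / k)
    have h3 : C / k = momentFactor L Λ * ((k : ℝ)⁻¹ * V)
        + (k : ℝ)⁻¹ * (2 * L ^ 2 * Real.exp (L + Λ + Λ ^ 2 / 2)) := by
      rw [hC, horizonFactor]
      ring
    linarith
  calc _ ≤ ∫⁻ b : Fin m → Ξ, ENNReal.ofReal (Real.exp (-(C / k))) * ENNReal.ofReal (Real.exp
        (q * inner ℝ (e - clip (batchOracle g x b) lam) (x - xs) / ψ
          + (q * ‖clip (batchOracle g x b) lam‖) ^ 2 / 2)) ∂(Measure.pi fun _ => μ) := by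
        refine lintegral_mono fun b => ?_
        rw [← ENNReal.ofReal_mul (Real.exp_nonneg _), ← Real.exp_add]
        refine ENNReal.ofReal_le_ofReal (Real.exp_le_exp.2 ?_)
        linarith [hpt b]
    _ = ENNReal.ofReal (Real.exp (-(C / k))) * ∫⁻ b : Fin m → Ξ, ENNReal.ofReal (Real.exp
        (q * inner ℝ (e - clip (batchOracle g x b) lam) (x - xs) / ψ
          + (q * ‖clip (batchOracle g x b) lam‖) ^ 2 / 2)) ∂(Measure.pi fun _ => μ) :=
        lintegral_const_mul' _ _ ENNReal.ofReal_ne_top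
    _ ≤ ENNReal.ofReal (Real.exp (-(C / k))) * ENNReal.ofReal (Real.exp (C / k)) := by
        gcongr
        exact hstep.trans (ENNReal.ofReal_le_ofReal hgrow)
    _ = 1 := by
        rw [← ENNReal.ofReal_mul (Real.exp_nonneg _), ← Real.exp_add, neg_add_cancel,
          Real.exp_zero, ENNReal.ofReal_one]

variable [SecondCountableTopology H] [MeasurableSpace H] [BorelSpace H]

/-- The potential plus the accumulated weighted excess stays small with high probability. -/
lemma measure_exists_potential_ge_le (hm : 1 ≤ m) (hp : 1 ≤ p) (hp2 : p ≤ 2)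
    (hf : Measurable f) (hg : Measurable (fun q : H × Ξ => g q.1 q.2))
    (hgi : ∀ x, Integrable (g x) μ) (hgL : ∀ x, ‖∫ w, g x w ∂μ‖ ≤ L)
    (hgh : ∀ x w, ‖g x w‖ ≤ h w) (hh : Integrable (fun w => h w ^ p) μ)
    (hV : ∫ w, h w ^ p ∂μ ≤ V) (hC : 0 ≤ horizonFactor L (max Lε 1) V)
    (hsub : ∀ x, f x - f xs ≤ inner ℝ (∫ w, g x w ∂μ) (x - xs))
    (hγ : 0 < γ) (hγ1 : γ ≤ 1) (hk : 1 ≤ k) {ξ : ℕ → Fin m → Ω → Ξ}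
    (hξ : ∀ i j, Measurable (ξ i j)) (hlaw : ∀ i j, P.map (ξ i j) = μ)
    (hindep : iIndepFun (fun ij : ℕ × Fin m => ξ ij.1 ij.2) P) (x₁ : H) {δ : ℝ} (hδ : 0 < δ) :
    P {ω | ∃ n ≤ k, potential xs x₁
          + γ * (Real.log (1 / δ) + horizonFactor L (max Lε 1) V)
        ≤ potential xs (iterate g (fhStep p γ k) (fhLevel p Lε 1 k) x₁ (fun i j => ξ i j ω) n)
          + ∑ i ∈ Finset.range n, fhStep p γ k 0
            * (f (iterate g (fhStep p γ k) (fhLevel p Lε 1 k) x₁ (fun i j => ξ i j ω) i) - f xs)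
            / potential xs
              (iterate g (fhStep p γ k) (fhLevel p Lε 1 k) x₁ (fun i j => ξ i j ω) i)}
      ≤ ENNReal.ofReal δ := by
  have hk0 : (0 : ℝ) < k := by exact_mod_cast hk
  set C := horizonFactor L (max Lε 1) V with hCdef
  -- The schedules are constant in the iteration, so index 0 stands for every step.
  set η := fhStep p γ k 0 with hη
  set lam := fhLevel p Lε 1 k 0 with hlam
  set X : ℕ → Ω → H := fun n ω =>
    iterate g (fhStep p γ k) (fhLevel p Lε 1 k) x₁ (fun i j => ξ i j ω) n with hX
  set F : H × (Fin m → Ξ) → H := fun y => y.1 - η • clip (batchOracle g y.1 y.2) lam with hF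
  set E : H × (Fin m → Ξ) → ℝ := fun y =>
    (potential xs (F y) - potential xs y.1 + η * (f y.1 - f xs) / potential xs y.1) / γ - C / k
    with hE
  have hpot : Measurable (potential xs) := by
    unfold potential
    fun_prop
  have hFm : Measurable F := by
    have h1 : Measurable (fun y : H × (Fin m → Ξ) => clip (batchOracle g y.1 y.2) lam) :=
      (measurable_clip lam).comp (measurable_uncurry_batchOracle hg)
    exact measurable_fst.sub (h1.const_smul η)
  have hEm : Measurable E := by
    have h1 : Measurable fun y : H × (Fin m → Ξ) => potential xs (F y) := hpot.comp hFm
    have h2 : Measurable fun y : H × (Fin m → Ξ) => potential xs y.1 := hpot.comp measurable_fst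
    have h3 : Measurable fun y : H × (Fin m → Ξ) => f y.1 := hf.comp measurable_fst
    fun_prop
  -- The potential differences telescope, so the product in Ville's inequality is the exponential of
  -- this expression.
  have hsum : ∀ n ω, ∑ i ∈ Finset.range n, E (X i ω, fun j => ξ i j ω)
      = (potential xs (X n ω) - potential xs x₁
        + ∑ i ∈ Finset.range n, η * (f (X i ω) - f xs) / potential xs (X i ω)) / γ
        - n * (C / k) := by
    intro n ω
    induction n with
    | zero => simp [hX, iterate]
    | succ n ih =>
      rw [Finset.sum_range_succ, ih, Finset.sum_range_succ]
      have : F (X n ω, fun j => ξ n j ω) = X (n + 1) ω := rfl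
      simp only [hE, this]
      push_cast
      ring
  have hville := measure_exists_le_prod_le (P := P) (X := X) (b := fun n ω j => ξ n j ω)
    hFm (x₀ := x₁) (fun _ => rfl) (fun _ _ => rfl) (fun n => measurable_pi_lambda _ (hξ n))
    (indep_past_batch hξ hindep) (g := fun y => ENNReal.ofReal (Real.exp (E y)))
    (hEm.exp.ennreal_ofReal)
    (fun n x => by
      rw [map_batch_eq_pi hξ hlaw hindep n]
      exact lintegral_exp_potential_step_le hm hp hp2 (hgi x) (hgL x) (hgh x) hh hV (hsub x)
        hγ hγ1 hk)
    (a := ENNReal.ofReal (1 / δ)) (by simpa using hδ) ENNReal.ofReal_ne_top k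
  rw [← ENNReal.ofReal_inv_of_pos (by positivity), one_div, inv_inv] at hville
  refine (measure_mono ?_).trans hville
  rintro ω ⟨n, hn, hle⟩
  refine ⟨n, hn, ?_⟩
  rw [← ENNReal.ofReal_prod_of_nonneg fun _ _ => Real.exp_nonneg _, ← Real.exp_sum, hsum n ω]
  refine ENNReal.ofReal_le_ofReal ?_
  rw [← Real.exp_log (inv_pos.2 hδ), ← one_div δ]
  refine Real.exp_le_exp.2 ?_
  have hnk : n * (C / k) ≤ C := by
    have : (n : ℝ) ≤ k := by exact_mod_cast hn
    calc n * (C / k) ≤ k * (C / k) := by gcongr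
      _ = C := by field_simp
  have hdiv : Real.log (1 / δ) + C ≤ (potential xs (X n ω) - potential xs x₁
        + ∑ i ∈ Finset.range n, η * (f (X i ω) - f xs) / potential xs (X i ω)) / γ := by
    rw [le_div_iff₀ hγ]
    linarith
  linarith

/-- High-probability excess bound for the averaged iterate on an unbounded domain. -/
lemma measure_average_excess_gt_le (hm : 1 ≤ m) (hp : 1 ≤ p) (hp2 : p ≤ 2)
    (hf : Measurable f) (hconv : ConvexOn ℝ Set.univ f) (hmin : ∀ x, f xs ≤ f x)
    (hg : Measurable (fun q : H × Ξ => g q.1 q.2))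
    (hgi : ∀ x, Integrable (g x) μ) (hgL : ∀ x, ‖∫ w, g x w ∂μ‖ ≤ L)
    (hgh : ∀ x w, ‖g x w‖ ≤ h w) (hh : Integrable (fun w => h w ^ p) μ)
    (hV : ∫ w, h w ^ p ∂μ ≤ V) (hC : 0 ≤ horizonFactor L (max Lε 1) V)
    (hsub : ∀ x, f x - f xs ≤ inner ℝ (∫ w, g x w ∂μ) (x - xs))
    (hγ : 0 < γ) (hγ1 : γ ≤ 1) (hk : 1 ≤ k) {ξ : ℕ → Fin m → Ω → Ξ}
    (hξ : ∀ i j, Measurable (ξ i j)) (hlaw : ∀ i j, P.map (ξ i j) = μ)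
    (hindep : iIndepFun (fun ij : ℕ × Fin m => ξ ij.1 ij.2) P) (x₁ : H) {δ : ℝ} (hδ : 0 < δ) :
    P {ω | (potential xs x₁ + γ * (Real.log (1 / δ) + horizonFactor L (max Lε 1) V)) ^ 2
          / (k * fhStep p γ k 0)
        < f (average g (fhStep p γ k) (fhLevel p Lε 1 k) x₁ (fun i j => ξ i j ω) k) - f xs}
      ≤ ENNReal.ofReal δ := by
  refine (measure_mono ?_).trans (measure_exists_potential_ge_le hm hp hp2 hf hg hgi hgL hgh hh
    hV hC hsub hγ hγ1 hk hξ hlaw hindep x₁ hδ)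
  intro ω hω
  by_contra hcon
  simp only [Set.mem_ofPred_eq, not_exists, not_and, not_le] at hω hcon
  refine absurd hω (not_lt.2 ?_)
  have hk0 : (0 : ℝ) < k := by exact_mod_cast hk
  set K := potential xs x₁ + γ * (Real.log (1 / δ) + horizonFactor L (max Lε 1) V) with hK
  have hη : 0 < fhStep p γ k 0 := by
    rw [fhStep]
    positivity
  set η := fhStep p γ k 0
  set X : ℕ → H := iterate g (fhStep p γ k) (fhLevel p Lε 1 k) x₁ (fun i j => ξ i j ω) with hX
  have hterm : ∀ i, 0 ≤ η * (f (X i) - f xs) / potential xs (X i) := fun i =>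
    div_nonneg (mul_nonneg hη.le (sub_nonneg.2 (hmin _)))
      (zero_le_one.trans (one_le_potential _ _))
  -- By minimality of `xs` the accumulated excess is nonnegative; dropping it bounds every iterate,
  -- and dropping the potential instead bounds the weighted sum.
  have hpotK : ∀ i ≤ k, potential xs (X i) ≤ K := fun i hi =>
    (le_add_of_nonneg_right (Finset.sum_nonneg fun j _ => hterm j)).trans (hcon i hi).le
  have hK0 : 0 ≤ K := (zero_le_one.trans (one_le_potential _ _)).trans (hpotK 0 (Nat.zero_le k))
  have hsumK : ∑ i ∈ Finset.range k, η * (f (X i) - f xs) / potential xs (X i) ≤ K := by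
    have := (hcon k le_rfl).le
    have := one_le_potential xs (X k)
    linarith
  -- Removing the weights 1/ψ costs one factor K, and the weighted sum supplies the other.
  have hsum : η * ∑ i ∈ Finset.range k, (f (X i) - f xs) ≤ K ^ 2 := by
    calc η * ∑ i ∈ Finset.range k, (f (X i) - f xs)
        = ∑ i ∈ Finset.range k, η * (f (X i) - f xs) := Finset.mul_sum ..
      _ ≤ ∑ i ∈ Finset.range k, K * (η * (f (X i) - f xs) / potential xs (X i)) := by
          refine Finset.sum_le_sum fun i hi => ?_
          have h1 : potential xs (X i) ≠ 0 :=
            (zero_lt_one.trans_le (one_le_potential _ _)).ne'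
          calc η * (f (X i) - f xs)
              = potential xs (X i) * (η * (f (X i) - f xs) / potential xs (X i)) := by
                field_simp
            _ ≤ _ := mul_le_mul_of_nonneg_right (hpotK i (Finset.mem_range.1 hi).le) (hterm i)
      _ = K * ∑ i ∈ Finset.range k, η * (f (X i) - f xs) / potential xs (X i) :=
          (Finset.mul_sum ..).symm
      _ ≤ K * K := by gcongr
      _ = K ^ 2 := (sq K).symm
  have havg : f (average g (fhStep p γ k) (fhLevel p Lε 1 k) x₁ (fun i j => ξ i j ω) k) - f xs
      ≤ (k : ℝ)⁻¹ * ∑ i ∈ Finset.range k, (f (X i) - f xs) := by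
    have h1 := hconv.map_sum_le (t := Finset.range k) (w := fun _ => (k : ℝ)⁻¹) (p := X)
      (fun _ _ => by positivity) (by simp [hk0.ne']) (fun _ _ => Set.mem_univ _)
    simp only [← Finset.smul_sum, smul_eq_mul, ← Finset.mul_sum] at h1
    rw [Finset.sum_sub_distrib, mul_sub, Finset.sum_const, Finset.card_range, nsmul_eq_mul,
      inv_mul_cancel_left₀ hk0.ne']
    exact sub_le_sub_right h1 _
  refine havg.trans ?_
  rw [le_div_iff₀ (by positivity)]
  calc ((k : ℝ)⁻¹ * ∑ i ∈ Finset.range k, (f (X i) - f xs)) * (k * η)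
      = η * ∑ i ∈ Finset.range k, (f (X i) - f xs) := by field_simp
    _ ≤ K ^ 2 := hsum

end Generic

/-! ### Rates and choice of the stepsize parameter -/

/-- Rate obtained from the potential bound when `1 ≤ γ log (2 / δ)`. -/
lemma sq_div_mul_fhStep_le {A C p γ δ : ℝ} {k : ℕ} (hp : 0 < p) (hA : 0 ≤ A) (hC : 0 ≤ C)
    (hγ : 0 < γ) (hδ : 0 < δ) (hΛ : 1 ≤ Real.log (2 / δ)) (hγΛ : 1 ≤ γ * Real.log (2 / δ))
    (hlog : 0 ≤ Real.log (1 / δ)) (hk : 1 ≤ k) :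
    (A + γ * (Real.log (1 / δ) + C)) ^ 2 / (k * fhStep p γ k 0)
      ≤ (A + 1 + C) ^ 2 * (γ * Real.log (2 / δ) ^ 2) / (k : ℝ) ^ ((p - 1) / p) := by
  have hk0 : (0 : ℝ) < k := by exact_mod_cast hk
  set Λ := Real.log (2 / δ) with hΛdef
  have hlogΛ : Real.log (1 / δ) ≤ Λ := Real.log_le_log (by positivity) (by gcongr; norm_num)
  have h1 : A + γ * (Real.log (1 / δ) + C) ≤ (A + 1 + C) * (γ * Λ) := by
    have h2 : A ≤ A * (γ * Λ) := le_mul_of_one_le_right hA hγΛ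
    have h3 : γ * Real.log (1 / δ) ≤ γ * Λ := by gcongr
    have h4 : γ * C ≤ C * (γ * Λ) := by
      have : γ * C * 1 ≤ γ * C * Λ := by gcongr
      linarith
    linarith
  have h0 : 0 ≤ A + γ * (Real.log (1 / δ) + C) := by positivity
  have hkη : k * fhStep p γ k 0 = γ * (k : ℝ) ^ ((p - 1) / p) := by
    have : (p - 1) / p = 1 - 1 / p := by field_simp
    rw [fhStep, this, Real.rpow_sub hk0, Real.rpow_one]
    ring
  rw [hkη]
  calc (A + γ * (Real.log (1 / δ) + C)) ^ 2 / (γ * (k : ℝ) ^ ((p - 1) / p))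
      ≤ ((A + 1 + C) * (γ * Λ)) ^ 2 / (γ * (k : ℝ) ^ ((p - 1) / p)) := by gcongr
    _ = _ := by field_simp

/-- A union bound replaces complementation, so no measurability of `X` is needed. -/
lemma one_sub_le_measureReal_of_measure_gt_le {Ω : Type*} [MeasurableSpace Ω] {P : Measure Ω}
    [IsProbabilityMeasure P] {X : Ω → ℝ} {a b δ : ℝ} (hδ : 0 ≤ δ) (hab : a ≤ b)
    (h : P {ω | a < X ω} ≤ ENNReal.ofReal δ) : 1 - δ ≤ P.real {ω | X ω ≤ b} := by
  have h1 : P.real {ω | a < X ω} ≤ δ := ENNReal.toReal_le_of_le_ofReal hδ h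
  have h2 : (Set.univ : Set Ω) ⊆ {ω | X ω ≤ b} ∪ {ω | a < X ω} := fun ω _ =>
    (le_or_gt (X ω) a).imp (fun h => h.trans hab) id
  have h3 := (measureReal_mono (μ := P) h2).trans (measureReal_union_le _ _)
  rw [probReal_univ] at h3
  linarith

lemma one_le_log_two_div {δ : ℝ} (hδ : 0 < δ) (hδ2 : δ ≤ 2 / Real.exp 1) :
    1 ≤ Real.log (2 / δ) := by
  rw [Real.le_log_iff_exp_le (by positivity), le_div_iff₀ hδ]
  rw [le_div_iff₀ (Real.exp_pos 1)] at hδ2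
  linarith

/-- Both parts follow from log(2/δ) = log 2 + log(1/δ) ≥ 1 and log 2 < 1. -/
lemma log_two_div_le_one_add_log {δ : ℝ} (hδ : 0 < δ) (hδ2 : δ ≤ 2 / Real.exp 1) :
    0 ≤ Real.log (1 / δ) ∧ Real.log (2 / δ) ≤ 1 + Real.log (1 / δ) := by
  have h1 := one_le_log_two_div hδ hδ2
  have h2 : Real.log (2 / δ) = Real.log 2 + Real.log (1 / δ) := by
    rw [← Real.log_mul (by norm_num) (by positivity), mul_one_div]
  have h3 := Real.log_two_lt_d9
  constructor <;> linarith

end ClippedSsGM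

end

theorem mainTheorem7
    {H : Type*} [NormedAddCommGroup H] [InnerProductSpace ℝ H] [CompleteSpace H]
    [TopologicalSpace.SeparableSpace H] [MeasurableSpace H] [BorelSpace H]
    {𝒵 𝒴 : Type*} [MeasurableSpace 𝒵] [MeasurableSpace 𝒴]
    -- the joint distribution of `(Z, Y)`
    (μ : Measure (𝒵 × 𝒴)) [IsProbabilityMeasure μ]
    -- the feature map and its moment condition
    (φ : 𝒵 → H) (hφ : Measurable φ)
    (p : ℝ) (hp1 : 1 < p) (hp2 : p ≤ 2) (ν : ℝ) (hν : 0 < ν)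
    (hφ_int : Integrable (fun w : 𝒵 × 𝒴 => ‖φ w.1‖ ^ p) μ)
    (hφ_mom : ∫ w, ‖φ w.1‖ ^ p ∂μ ≤ ν ^ p)
    -- the loss function, and a measurable selection of its subgradients
    (ℓ ℓ' : ℝ → 𝒴 → ℝ) (hℓ_meas : ∀ t, Measurable (ℓ t))
    (hℓ_nonneg : ∀ t y, 0 ≤ ℓ t y)
    (hℓ_conv : ∀ y, ConvexOn ℝ Set.univ (fun t => ℓ t y))
    (Lip : ℝ) (hLip : 0 < Lip) (hℓ_lip : ∀ y s t, |ℓ s y - ℓ t y| ≤ Lip * |s - t|)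
    (hℓ_int : Integrable (fun w : 𝒵 × 𝒴 => ℓ 0 w.2) μ)
    (hℓ'_meas : Measurable (fun q : ℝ × 𝒴 => ℓ' q.1 q.2))
    (hℓ'_sub : ClippedSsGM.IsSubgradientSelection ℓ ℓ')
    -- the risk has a minimizer
    (hmin : ∃ xs : H, ∀ x : H, ClippedSsGM.risk μ φ ℓ xs ≤ ClippedSsGM.risk μ φ ℓ x)
    -- `Lε = (1 + ε) L`, where `L = Lip * E‖φ(Z)‖`
    (ε : ℝ) (hε : 0 < ε) (Lε : ℝ) (hLε : Lε = (1 + ε) * (Lip * ∫ w, ‖φ w.1‖ ∂μ))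
    -- batch size, initial point, and independent copies `ξ i j` of `(Z, Y)`
    (m : ℕ) (hm : 1 ≤ m) (x₁ : H)
    {Ω : Type*} [MeasurableSpace Ω] (P : Measure Ω) [IsProbabilityMeasure P]
    (ξ : ℕ → Fin m → Ω → 𝒵 × 𝒴) (hξ_meas : ∀ i j, Measurable (ξ i j))
    (hξ_law : ∀ i j, P.map (ξ i j) = μ)
    (hξ_indep : iIndepFun (fun ij : ℕ × Fin m => ξ ij.1 ij.2) P) :
    ∃ c : ℝ, 0 ≤ c ∧ ∀ δ : ℝ, 0 < δ → δ ≤ 2 / Real.exp 1 → ∀ k : ℕ, 1 ≤ k →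
      -- stepsize parameter `γ = (log (2 / δ))⁻¹`
      (1 - δ ≤ P.real {ω |
        ClippedSsGM.risk μ φ ℓ
            (ClippedSsGM.average (ClippedSsGM.slOracle φ ℓ')
              (ClippedSsGM.fhStep p (Real.log (2 / δ))⁻¹ k) (ClippedSsGM.fhLevel p Lε 1 k)
              x₁ (fun i j => ξ i j ω) k)
          - ⨅ x : H, ClippedSsGM.risk μ φ ℓ x
        ≤ c * ((1 + Real.log (1 / δ)) / (k : ℝ) ^ ((p - 1) / p))}) ∧
      -- stepsize parameter `γ = (log (2 / δ))^(-1/2)`; the factor in front of the rate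
      -- does not depend on `k`
      (1 - δ ≤ P.real {ω |
        ClippedSsGM.risk μ φ ℓ
            (ClippedSsGM.average (ClippedSsGM.slOracle φ ℓ')
              (ClippedSsGM.fhStep p (Real.log (2 / δ) ^ (-(1 / 2) : ℝ)) k)
              (ClippedSsGM.fhLevel p Lε 1 k)
              x₁ (fun i j => ξ i j ω) k)
          - ⨅ x : H, ClippedSsGM.risk μ φ ℓ x
        ≤ c * Real.sqrt (Real.log (2 / δ))
            * ((1 + Real.log (1 / δ)) / (k : ℝ) ^ ((p - 1) / p))}) := by
  obtain ⟨xs, hxs⟩ := hmin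
  have := UniformSpace.secondCountable_of_separable H
  have hp0 : 0 < p := by linarith
  have hφm : Measurable (fun w : 𝒵 × 𝒴 => φ w.1) := hφ.comp measurable_fst
  -- The first moment is finite because t ≤ 1 + t^p for t ≥ 0.
  have hφi : Integrable (fun w : 𝒵 × 𝒴 => φ w.1) μ := by
    refine ((integrable_const (1 : ℝ)).add hφ_int).mono' hφm.aestronglyMeasurable
      (ae_of_all _ fun w => ?_)
    have h0 : 0 ≤ ‖φ w.1‖ ^ p := by positivity
    simp only [Pi.add_apply]
    rcases le_total ‖φ w.1‖ 1 with h | h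
    · linarith
    · have := Real.rpow_le_rpow_of_exponent_le h hp1.le
      rw [Real.rpow_one] at this
      linarith
  set L : ℝ := Lip * ∫ w, ‖φ w.1‖ ∂μ with hL
  set V : ℝ := ∫ w, (Lip * ‖φ w.1‖) ^ p ∂μ with hV
  have hV0 : 0 ≤ V := integral_nonneg fun w => by positivity
  have hh : Integrable (fun w : 𝒵 × 𝒴 => (Lip * ‖φ w.1‖) ^ p) μ := by
    simp only [Real.mul_rpow hLip.le (norm_nonneg _)]
    exact hφ_int.const_mul _
  set C := ClippedSsGM.horizonFactor L (max Lε 1) V with hC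
  have hC0 : 0 ≤ C := by
    have h1 := ClippedSsGM.momentFactor_nonneg L
      (zero_le_one.trans (le_max_right Lε 1))
    rw [hC, ClippedSsGM.horizonFactor]
    positivity
  have hgi := ClippedSsGM.integrable_slOracle hφ hφi hℓ_lip hℓ'_meas hℓ'_sub
  have hgh := ClippedSsGM.norm_slOracle_le (φ := φ) hℓ_lip hℓ'_sub
  have hgL : ∀ x : H, ‖∫ w, ClippedSsGM.slOracle φ ℓ' x w ∂μ‖ ≤ L := fun x => by
    rw [hL, ← integral_const_mul]
    exact norm_integral_le_of_norm_le (hφi.norm.const_mul Lip) (ae_of_all _ (hgh x))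
  have hinf : ⨅ x : H, ClippedSsGM.risk μ φ ℓ x = ClippedSsGM.risk μ φ ℓ xs :=
    le_antisymm (ciInf_le ⟨_, Set.forall_mem_range.2 hxs⟩ xs) (le_ciInf hxs)
  set A := ClippedSsGM.potential xs x₁ with hA
  have hA0 : 0 ≤ A := zero_le_one.trans (ClippedSsGM.one_le_potential xs x₁)
  -- Both stepsizes satisfy γ ≤ 1 ≤ γ log(2/δ), which is all that the bound requires of γ.
  have key : ∀ δ : ℝ, 0 < δ → δ ≤ 2 / Real.exp 1 → ∀ k : ℕ, 1 ≤ k → ∀ γ c' : ℝ, 0 < γ →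
      γ ≤ 1 → 1 ≤ γ * Real.log (2 / δ) →
      (A + 1 + C) ^ 2 * (γ * Real.log (2 / δ) ^ 2) / (k : ℝ) ^ ((p - 1) / p) ≤ c' →
      1 - δ ≤ P.real {ω |
        ClippedSsGM.risk μ φ ℓ
            (ClippedSsGM.average (ClippedSsGM.slOracle φ ℓ')
              (ClippedSsGM.fhStep p γ k) (ClippedSsGM.fhLevel p Lε 1 k)
              x₁ (fun i j => ξ i j ω) k)
          - ⨅ x : H, ClippedSsGM.risk μ φ ℓ x ≤ c'} := by
    intro δ hδ hδ2 k hk γ c' hγ hγ1 hγΛ hc'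
    rw [hinf]
    have hΛ := ClippedSsGM.one_le_log_two_div hδ hδ2
    exact ClippedSsGM.one_sub_le_measureReal_of_measure_gt_le hδ.le
      ((ClippedSsGM.sq_div_mul_fhStep_le hp0 hA0 hC0 hγ hδ hΛ hγΛ
        (ClippedSsGM.log_two_div_le_one_add_log hδ hδ2).1 hk).trans hc')
      (ClippedSsGM.measure_average_excess_gt_le hm hp1.le hp2
        (ClippedSsGM.measurable_risk hφ hℓ_meas hℓ_lip)
        (ClippedSsGM.convexOn_risk hφ hφi hLip.le hℓ_meas hℓ_conv hℓ_lip hℓ_int) hxs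
        (ClippedSsGM.measurable_uncurry_slOracle hφ hℓ'_meas) hgi hgL hgh hh le_rfl hC0
        (fun x => ClippedSsGM.risk_sub_risk_le hφ hφi hLip.le hℓ_meas hℓ_lip hℓ_int hℓ'_meas
          hℓ'_sub x xs)
        hγ hγ1 hk hξ_meas hξ_law hξ_indep x₁ hδ)
  -- Neither A nor C depends on k or δ. What remains is γΛ², equal to Λ for γ = Λ⁻¹ and to √Λ · Λ
  -- for γ = Λ^(-1/2), with Λ ≤ 1 + log(1/δ).
  refine ⟨(A + 1 + C) ^ 2, by positivity, fun δ hδ hδ2 k hk => ?_⟩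
  have hΛ := ClippedSsGM.one_le_log_two_div hδ hδ2
  have hlog := (ClippedSsGM.log_two_div_le_one_add_log hδ hδ2).2
  set Λ := Real.log (2 / δ) with hΛdef
  have hΛ0 : 0 < Λ := by linarith
  constructor
  · refine key δ hδ hδ2 k hk _ _ (by positivity) (inv_le_one_of_one_le₀ hΛ)
      (inv_mul_cancel₀ hΛ0.ne').ge ?_
    rw [← mul_div_assoc]
    gcongr
    rw [sq, inv_mul_cancel_left₀ hΛ0.ne']
    exact hlog
  · have hs1 : 1 ≤ √Λ := Real.one_le_sqrt.2 hΛ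
    have hss : √Λ * √Λ = Λ := Real.mul_self_sqrt hΛ0.le
    have hγ : Λ ^ (-(1 / 2) : ℝ) = (√Λ)⁻¹ := by
      rw [Real.rpow_neg hΛ0.le, ← Real.sqrt_eq_rpow]
    have hγΛ : (√Λ)⁻¹ * Λ = √Λ := by
      rw [← hss, ← mul_assoc]
      simp [hss, (zero_lt_one.trans_le hs1).ne']
    rw [hγ]
    refine key δ hδ hδ2 k hk _ _ (by positivity) (inv_le_one_of_one_le₀ hs1)
      (by rw [hγΛ]; exact hs1) ?_
    have hrate : (√Λ)⁻¹ * Λ ^ 2 ≤ √Λ * (1 + Real.log (1 / δ)) := by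
      rw [sq, ← mul_assoc, hγΛ]
      gcongr
    rw [← mul_div_assoc, mul_assoc _ (√Λ)]
    exact div_le_div_of_nonneg_right (mul_le_mul_of_nonneg_left hrate (sq_nonneg _))
      (by positivity)
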